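/- A class $\mathcal K$ of (abstract) groups is a *class of reducts of an $L_{\omega_1\omega}$-axiomatizable class* if there are a countable set $L$ of new relation and function symbols and a countable set $T$ of $L_{\omega_1\omega}$-sentences in the language of groups $(1,{}^{-1},\cdot)$ expanded by $L$ such that the reducts of the models of $T$ to the language of groups are exactly the groups in $\mathcal K$. The class $\mathcal K$ is *bountiful* if for all infinite groups $G\le H$ with $H\in\mathcal K$ there is $K\in\mathcal K$ with $G\le K\le H$ and $|K|=|G|$. A group $G$ is *Cayley bounded* if for every generating set $U\subseteq G$ there is $n\in\mathbb N$ such that every element of $G$ is a product of $n$ elements of $U\cup U^{-1}\cup\{1\}$. It has *cofinality $\le\omega$* if it is the union of a strictly increasing sequence $(H_n)_{n\in\mathbb N}$ of proper subgroups. It is *strongly bounded* if it is Cayley bounded and does not have cofinality $\le\omega$. It has *property FA* if every action of $G$ by automorphisms on a simplicial tree fixes a point (a vertex, or the midpoint of an edge). **Proposition.** Each of the following classes of groups is a class of reducts of an $L_{\omega_1\omega}$-axiomatizable class, and each of them is bountiful: 1. the class of groups that are not strongly bounded; 2. the class of groups of cofinality $\le\omega$; 3. the class of groups that are not Cayley bounded;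 4. the class of non-trivial free products with amalgamation, i.e. groups isomorphic to some $A*_C B$ with $C\ne A$ and $C\ne B$; the class of groups isomorphic to an HNN extension of some group; and the union of these two classes; 5. the class of groups that admit a homomorphism onto $\mathbb Z$. Moreover, the class of groups that do not have property FA is bountiful. -/

import Mathlib

open scoped Pointwise

universe u

namespace GroupClass

open FirstOrder

/-! ### The infinitary logic `L_{ω₁ω}` -/

/-- Formulas of `L_{ω₁ω}` over the signature `L` whose free variables are among `x₀, …, x_{n-1}`:
first-order formulas, closed in addition under countable conjunctions.  The other connectives
(negation, disjunction, countable disjunction, `∃`) are the classical abbreviations. As only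
finitely many quantifiers stand above a subformula, every subformula of a sentence has finitely
many free variables, so nothing is lost by indexing with `n`. -/
inductive InfFormula (L : FirstOrder.Language.{0, 0}) : ℕ → Type
  | falsum {n : ℕ} : InfFormula L n
  | equal {n : ℕ} (t₁ t₂ : L.Term (Fin n)) : InfFormula L n
  | rel {n l : ℕ} (R : L.Relations l) (ts : Fin l → L.Term (Fin n)) : InfFormula L n
  | imp {n : ℕ} (φ ψ : InfFormula L n) : InfFormula L n
  | all {n : ℕ} (φ : InfFormula L (n + 1)) : InfFormula L n
  | conj {n : ℕ} (φ : ℕ → InfFormula L n) : InfFormula L n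

/-- Satisfaction of an `L_{ω₁ω}`-formula in a structure under an assignment. The quantifier
binds the last variable. -/
def InfFormula.Realize {L : FirstOrder.Language.{0, 0}} {M : Type u} [L.Structure M] :
    {n : ℕ} → InfFormula L n → (Fin n → M) → Prop
  | _, .falsum, _ => False
  | _, .equal t₁ t₂, v => t₁.realize v = t₂.realize v
  | _, .rel R ts, v => FirstOrder.Language.Structure.RelMap R fun i => (ts i).realize v
  | _, .imp φ ψ, v => φ.Realize v → ψ.Realize v
  | _, .all φ, v => ∀ x : M, φ.Realize (Fin.snoc v x)
  | _, .conj φ, v => ∀ k : ℕ, (φ k).Realize v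

/-- `M` is a model of the set `T` of `L_{ω₁ω}`-sentences. -/
def IsModel {L : FirstOrder.Language.{0, 0}} (T : Set (InfFormula L 0)) (M : Type u) [L.Structure M] : Prop :=
  ∀ φ ∈ T, φ.Realize (Fin.elim0 : Fin 0 → M)

/-! ### Groups as structures, and classes of reducts -/

/-- The function symbols of the language of groups. -/
inductive GroupFunc : ℕ → Type
  | one : GroupFunc 0
  | inv : GroupFunc 1
  | mul : GroupFunc 2

/-- The language of groups `(1, ⁻¹, ·)`. -/
def groupLang : FirstOrder.Language.{0, 0} where
  Functions := GroupFunc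
  Relations := fun _ => Empty

/-- A group as a structure for the language of groups. -/
abbrev groupStructure (G : Type u) [Group G] : groupLang.Structure G where
  funMap := fun {_} f =>
    match f with
    | .one => fun _ => 1
    | .inv => fun x => (x 0)⁻¹
    | .mul => fun x => x 0 * x 1
  RelMap := fun {_} R => Empty.elim R

/-- The class `K` of groups is the class of reducts of an axiomatizable class of `L_{ω₁ω}`:
there are a countable set `L` of new symbols and a countable set `T` of `L_{ω₁ω}`-sentences in
the language of groups expanded by `L`, such that the reducts of the models of `T` to the language
of groups are exactly the groups in `K`. -/
def IsReductOfAxiomatizable (K : ∀ (G : Type u) [Group G], Prop) : Prop :=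
  ∃ (L : FirstOrder.Language.{0, 0}) (T : Set (InfFormula (groupLang.sum L) 0)),
    Countable L.Symbols ∧ T.Countable ∧
    ∀ (M : Type u) (S : groupLang.Structure M),
      (∃ _ : L.Structure M, IsModel T M) ↔ ∃ _ : Group M, S = groupStructure M ∧ K M

/-- The class `K` is bountiful: for all infinite groups `G ≤ H` with `H ∈ K` there is `N ∈ K`
with `G ≤ N ≤ H` and `|N| = |G|`. -/
def IsBountiful (K : ∀ (G : Type u) [Group G], Prop) : Prop :=
  ∀ (H : Type u) [Group H], K H → ∀ G : Subgroup H, Infinite G →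
    ∃ N : Subgroup H, G ≤ N ∧ K N ∧ Cardinal.mk N = Cardinal.mk G

/-! ### The classes of groups -/

section

variable (G : Type u) [Group G]

/-- For every generating subset `U` there is `n` such that every element is a product of `n`
elements of `U ∪ U⁻¹ ∪ {1}`. -/
def IsCayleyBounded : Prop :=
  ∀ U : Set G, Subgroup.closure U = ⊤ → ∃ n : ℕ, ∀ g : G, g ∈ (U ∪ U⁻¹ ∪ {1}) ^ n

/-- Cofinality `≤ ω`: the group is the union of a strictly increasing sequence of proper
subgroups. -/
def HasCofinalityLeOmega : Prop :=
  ∃ H : ℕ → Subgroup G, StrictMono H ∧ (∀ n, H n ≠ ⊤) ∧ ∀ g : G, ∃ n, g ∈ H n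

/-- Cayley bounded and of cofinality `> ω`. -/
def IsStronglyBounded : Prop :=
  IsCayleyBounded G ∧ ¬ HasCofinalityLeOmega G

/-- `G` is isomorphic to a free product `A₀ *_C A₁` with amalgamation in which the amalgamated
group `C` is a proper subgroup of both factors. -/
def IsNontrivialAmalgam : Prop :=
  ∃ (C : Type u) (_ : Group C) (A : Fin 2 → Type u) (_ : ∀ i, Group (A i))
    (φ : ∀ i, C →* A i),
    (∀ i, Function.Injective (φ i)) ∧ (∀ i, ¬ Function.Surjective (φ i)) ∧
      Nonempty (G ≃* Monoid.PushoutI φ)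

/-- `G` is isomorphic to an HNN extension `⟨B, t | t a t⁻¹ = φ(a), a ∈ A₁⟩` of a group `B`, for an
isomorphism `φ` between subgroups `A₁`, `A₂` of `B`. -/
def IsHNN : Prop :=
  ∃ (B : Type u) (_ : Group B) (A₁ A₂ : Subgroup B) (φ : A₁ ≃* A₂),
    Nonempty (G ≃* HNNExtension B A₁ A₂ φ)

/-- `G` has a homomorphism onto `ℤ`. -/
def MapsOntoInt : Prop :=
  ∃ f : G →* Multiplicative ℤ, Function.Surjective f

/-- Property FA: every action of `G` by automorphisms on a simplicial tree fixes a point of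
(the geometric realization of) the tree. A group of automorphisms that fixes an inner point of an
edge maps that edge to itself, and then it fixes its midpoint; so a fixed point is a fixed vertex
or an invariant edge. It suffices to look at trees in the universe of `G`: the subtree spanned by
an orbit has at most `max(|G|, ℵ₀)` vertices. -/
def HasFA : Prop :=
  ∀ (V : Type u) (X : SimpleGraph V), X.IsTree → ∀ ρ : G →* (X ≃g X),
    (∃ v : V, ∀ g : G, ρ g v = v) ∨
      ∃ v w : V, X.Adj v w ∧ ∀ g : G, s(ρ g v, ρ g w) = s(v, w)

end

end GroupClass

open GroupClass

/-! Classes (1)–(5) consist of the groups that can be expanded by countably many subsets satisfying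
a single $L_{\omega_1\omega}$-sentence; adding the group axioms makes them classes of reducts
(`IsPredicateReduct.isReductOfAxiomatizable`). The subsets are a generating set, a chain of
subgroups, the fibres of a homomorphism to $\mathbb Z$, the two factors of an amalgam, or the base
and the stable letter of an HNN extension. Generation is expressible because countable disjunctions
are available: every element lies in some power of the symmetrized set. For amalgams and HNN
extensions the normal form theorems replace the universal property by a condition on reduced words:
alternating products avoid the intersection of the factors, and reduced words containing the stable
letter avoid the base (`isNontrivialAmalgam_iff`, `isHNN_iff`). For each word length this is
definable.

Bountifulness of any class of reducts is a downward Löwenheim–Skolem argument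
(`IsReductOfAxiomatizable.isBountiful`). Countably many sentences have countably many subformulas,
each with finitely many free variables, so the infinite subgroup `G` can be closed under all Skolem
functions and operations of the expanded language without a change of cardinality. The Tarski–Vaught
test shows that the result is still a model.

Failure of property FA is witnessed by a tree outside the group. There the same closure argument is
run directly on the disjoint union of the group and the vertex set (`isBountiful_not_hasFA`). -/

namespace GroupClass

open FirstOrder FirstOrder.Language Cardinal

/-! ### Renaming variables and derived connectives -/

namespace InfFormula

variable {L : FirstOrder.Language.{0, 0}} {M : Type u} [L.Structure M]

/-- Renaming of the free variables. -/
def rename : {n : ℕ} → InfFormula L n → {m : ℕ} → (Fin n → Fin m) → InfFormula L m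
  | _, .falsum, _, _ => .falsum
  | _, .equal t₁ t₂, _, f => .equal (t₁.relabel f) (t₂.relabel f)
  | _, .rel R ts, _, f => .rel R fun i => (ts i).relabel f
  | _, .imp φ ψ, _, f => .imp (φ.rename f) (ψ.rename f)
  | _, .all φ, m, f => .all (φ.rename (Fin.snoc (fun i => (f i).castSucc) (Fin.last m)))
  | _, .conj φ, _, f => .conj fun k => (φ k).rename f

theorem realize_rename {n : ℕ} (φ : InfFormula L n) {m : ℕ} (f : Fin n → Fin m) (v : Fin m → M) :
    (φ.rename f).Realize v ↔ φ.Realize (v ∘ f) := by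
  induction φ generalizing m with
  | falsum => rfl
  | equal t₁ t₂ => simp [rename, Realize, Term.realize_relabel]
  | rel R ts => simp [rename, Realize, Term.realize_relabel]
  | imp φ ψ ih₁ ih₂ => simp [rename, Realize, ih₁, ih₂]
  | all φ ih =>
    simp only [rename, Realize, ih]
    refine forall_congr' fun x => ?_
    have : (Fin.snoc v x : Fin (m + 1) → M) ∘
        (Fin.snoc (fun i => (f i).castSucc) (Fin.last m)) = Fin.snoc (v ∘ f) x := by
      funext i
      refine Fin.lastCases ?_ (fun i => ?_) i <;> simp
    rw [this]
  | conj φ ih => simp [rename, Realize, ih]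

/-- Negation. -/
def neg {n : ℕ} (φ : InfFormula L n) : InfFormula L n := .imp φ .falsum

/-- Existential quantification. -/
def ex {n : ℕ} (φ : InfFormula L (n + 1)) : InfFormula L n := neg (.all (neg φ))

/-- Binary conjunction. -/
def and {n : ℕ} (φ ψ : InfFormula L n) : InfFormula L n := neg (.imp φ (neg ψ))

theorem realize_neg {n : ℕ} (φ : InfFormula L n) (v : Fin n → M) :
    φ.neg.Realize v ↔ ¬ φ.Realize v := Iff.rfl

theorem realize_ex {n : ℕ} (φ : InfFormula L (n + 1)) (v : Fin n → M) :
    φ.ex.Realize v ↔ ∃ x, φ.Realize (Fin.snoc v x) := by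
  simp only [ex, realize_neg, Realize, not_forall, not_not]

theorem realize_and {n : ℕ} (φ ψ : InfFormula L n) (v : Fin n → M) :
    (φ.and ψ).Realize v ↔ φ.Realize v ∧ ψ.Realize v := by
  simp only [and, realize_neg, Realize, Classical.not_imp, not_not]

end InfFormula

/-! ### Groups with countably many distinguished subsets -/

/-- Unary relation symbols indexed by `ℕ`. -/
inductive UnaryRel : ℕ → Type
  | sym (k : ℕ) : UnaryRel 1

/-- The language with countably many unary relation symbols. -/
def predLang : FirstOrder.Language.{0, 0} where
  Functions := fun _ => Empty
  Relations := UnaryRel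

/-- A sequence of subsets as a structure for `predLang`. -/
abbrev predStructure {M : Type u} (R : ℕ → Set M) : predLang.Structure M where
  funMap := fun {_} f => Empty.elim f
  RelMap := fun {_} r =>
    match r with
    | .sym k => fun x => x 0 ∈ R k

/-- The language of groups with countably many predicates. -/
abbrev groupPredLang : FirstOrder.Language.{0, 0} := groupLang.sum predLang

theorem exists_predStructure_eq {M : Type u} (S : predLang.Structure M) :
    ∃ R : ℕ → Set M, S = predStructure R := by
  refine ⟨fun k => {x | S.RelMap (UnaryRel.sym k : predLang.Relations 1) fun _ => x}, ?_⟩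
  refine FirstOrder.Language.Structure.ext ?_ ?_
  · funext n f; exact Empty.elim f
  · funext n r x
    cases r with
    | sym k =>
      change S.RelMap _ x = S.RelMap _ fun _ => x 0
      congr 1
      funext i
      rw [Subsingleton.elim i 0]

instance : Countable groupLang.Symbols := by
  have h : ∀ n, Countable (groupLang.Functions n) := by
    intro n
    change Countable (GroupFunc n)
    have : Subsingleton (GroupFunc n) := ⟨by rintro (_ | _ | _) b <;> cases b <;> rfl⟩
    infer_instance
  have h' : ∀ n, Countable (groupLang.Relations n) := fun n =>
    inferInstanceAs (Countable Empty)
  exact inferInstanceAs (Countable ((Σ l, groupLang.Functions l) ⊕ Σ l, groupLang.Relations l))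

instance : Countable predLang.Symbols := by
  have h : ∀ n, Countable (predLang.Functions n) := fun n => inferInstanceAs (Countable Empty)
  have h' : ∀ n, Countable (predLang.Relations n) := by
    intro n
    change Countable (UnaryRel n)
    refine Function.Injective.countable (f := fun r : UnaryRel n => match r with | .sym k => k) ?_
    rintro ⟨a⟩ ⟨b⟩ h
    exact congrArg UnaryRel.sym h
  exact inferInstanceAs (Countable ((Σ l, predLang.Functions l) ⊕ Σ l, predLang.Relations l))

/-- Satisfaction in a group with a sequence of distinguished subsets. -/
def Holds {M : Type u} [Group M] (R : ℕ → Set M) {n : ℕ} (φ : InfFormula groupPredLang n)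
    (v : Fin n → M) : Prop :=
  let _ := groupStructure M
  let _ := predStructure R
  φ.Realize v

theorem holds_and {M : Type u} [Group M] (R : ℕ → Set M) {n : ℕ}
    (φ ψ : InfFormula groupPredLang n) (v : Fin n → M) :
    Holds R (φ.and ψ) v ↔ Holds R φ v ∧ Holds R ψ v :=
  let _ := groupStructure M
  let _ := predStructure R
  InfFormula.realize_and φ ψ v

/-- The term `t₁ * t₂`. -/
def mulTerm {L : FirstOrder.Language.{0, 0}} {n : ℕ} (t₁ t₂ : (groupLang.sum L).Term (Fin n)) :
    (groupLang.sum L).Term (Fin n) :=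
  .func (Sum.inl GroupFunc.mul : (groupLang.sum L).Functions 2) ![t₁, t₂]

/-- The term `t⁻¹`. -/
def invTerm {L : FirstOrder.Language.{0, 0}} {n : ℕ} (t : (groupLang.sum L).Term (Fin n)) :
    (groupLang.sum L).Term (Fin n) :=
  .func (Sum.inl GroupFunc.inv : (groupLang.sum L).Functions 1) ![t]

/-- The term `1`. -/
def oneTerm {L : FirstOrder.Language.{0, 0}} {n : ℕ} : (groupLang.sum L).Term (Fin n) :=
  .func (Sum.inl GroupFunc.one : (groupLang.sum L).Functions 0) ![]

section

variable {M : Type u} [S : groupLang.Structure M] [predLang.Structure M] {n : ℕ}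
  (t₁ t₂ : groupPredLang.Term (Fin n)) (v : Fin n → M)

theorem realize_mulTerm : (mulTerm t₁ t₂).realize v =
    S.funMap (GroupFunc.mul : groupLang.Functions 2) ![t₁.realize v, t₂.realize v] := by
  change S.funMap (GroupFunc.mul : groupLang.Functions 2) _ = _
  congr 1
  funext i
  fin_cases i <;> rfl

theorem realize_invTerm : (invTerm t₁).realize v =
    S.funMap (GroupFunc.inv : groupLang.Functions 1) ![t₁.realize v] := by
  change S.funMap (GroupFunc.inv : groupLang.Functions 1) _ = _
  congr 1
  funext i
  fin_cases i; rfl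

theorem realize_oneTerm : (oneTerm : groupPredLang.Term (Fin n)).realize v =
    S.funMap (GroupFunc.one : groupLang.Functions 0) ![] := by
  change S.funMap (GroupFunc.one : groupLang.Functions 0) _ = _
  congr 1
  exact Subsingleton.elim _ _

end

/-- The group axioms. -/
def groupAxioms : Set (InfFormula groupPredLang 0) :=
  {.all (.all (.all (.equal (mulTerm (mulTerm (.var 0) (.var 1)) (.var 2))
      (mulTerm (.var 0) (mulTerm (.var 1) (.var 2)))))),
    .all (.equal (mulTerm oneTerm (.var 0)) (.var 0)),
    .all (.equal (mulTerm (invTerm (.var 0)) (.var 0)) oneTerm)}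

theorem isModel_groupAxioms_iff {M : Type u} (S : groupLang.Structure M) [predLang.Structure M] :
    IsModel groupAxioms M ↔ ∃ _ : Group M, S = groupStructure M := by
  simp only [IsModel, groupAxioms, Set.mem_insert_iff, Set.mem_singleton_iff, forall_eq_or_imp,
    forall_eq, InfFormula.Realize, realize_mulTerm, realize_invTerm, realize_oneTerm, Term.realize]
  constructor
  · rintro ⟨h₁, h₂, h₃⟩
    let _ : Mul M := ⟨fun a b => S.funMap (GroupFunc.mul : groupLang.Functions 2) ![a, b]⟩
    let _ : Inv M := ⟨fun a => S.funMap (GroupFunc.inv : groupLang.Functions 1) ![a]⟩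
    let _ : One M := ⟨S.funMap (GroupFunc.one : groupLang.Functions 0) ![]⟩
    refine ⟨Group.ofLeftAxioms h₁ h₂ h₃, ?_⟩
    refine FirstOrder.Language.Structure.ext ?_ ?_
    · funext n f x
      cases f with
      | one =>
        change S.funMap _ _ = S.funMap _ _
        congr 1
        exact Subsingleton.elim _ _
      | inv =>
        change S.funMap _ _ = S.funMap _ _
        congr 1
        funext i; fin_cases i; rfl
      | mul =>
        change S.funMap _ _ = S.funMap _ _
        congr 1
        funext i; fin_cases i <;> rfl
    · funext n r; exact Empty.elim r
  · rintro ⟨_, rfl⟩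
    exact ⟨fun x y z => mul_assoc x y z, fun x => one_mul x, fun x => inv_mul_cancel x⟩

/-! ### Definable sets and definable properties -/

/-- A set that is definable, uniformly in all groups with a sequence of distinguished subsets. -/
def DefinableSet (S : ∀ (M : Type u) [Group M], (ℕ → Set M) → Set M) : Prop :=
  ∃ φ : InfFormula groupPredLang 1, ∀ (M : Type u) [Group M] (R : ℕ → Set M) (v : Fin 1 → M),
    Holds R φ v ↔ v 0 ∈ S M R

/-- A property of groups with a sequence of distinguished subsets that is expressed by a
sentence. -/
def DefinableProp (P : ∀ (M : Type u) [Group M], (ℕ → Set M) → Prop) : Prop :=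
  ∃ φ : InfFormula groupPredLang 0, ∀ (M : Type u) [Group M] (R : ℕ → Set M) (v : Fin 0 → M),
    Holds R φ v ↔ P M R

namespace DefinableSet

variable {S S' : ∀ (M : Type u) [Group M], (ℕ → Set M) → Set M}

theorem symbol (k : ℕ) : DefinableSet.{u} (fun _ _ R => R k) :=
  ⟨.rel (Sum.inr (UnaryRel.sym k) : groupPredLang.Relations 1) ![.var 0], fun _ _ _ _ => Iff.rfl⟩

theorem one : DefinableSet.{u} (fun M _ _ => (1 : Set M)) := by
  refine ⟨.equal (.var 0) oneTerm, fun M _ R v => ?_⟩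
  simp only [Holds, InfFormula.Realize, realize_oneTerm, Term.realize]
  exact Iff.rfl

theorem compl (h : DefinableSet S) : DefinableSet (fun M _ R => (S M R)ᶜ) := by
  obtain ⟨φ, hφ⟩ := h
  exact ⟨φ.neg, fun M _ R v => not_congr (hφ M R v)⟩

theorem inter (h : DefinableSet S) (h' : DefinableSet S') :
    DefinableSet (fun M _ R => S M R ∩ S' M R) := by
  obtain ⟨φ, hφ⟩ := h
  obtain ⟨ψ, hψ⟩ := h'
  exact ⟨φ.and ψ, fun M _ R v =>
    (holds_and R φ ψ v).trans (and_congr (hφ M R v) (hψ M R v))⟩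

theorem union (h : DefinableSet S) (h' : DefinableSet S') :
    DefinableSet (fun M _ R => S M R ∪ S' M R) := by
  simpa only [Set.compl_inter, compl_compl] using (h.compl.inter h'.compl).compl

theorem diff (h : DefinableSet S) (h' : DefinableSet S') :
    DefinableSet (fun M _ R => S M R \ S' M R) := by
  simpa only [Set.sdiff_eq] using h.inter h'.compl

theorem iInter {S : ℕ → ∀ (M : Type u) [Group M], (ℕ → Set M) → Set M}
    (h : ∀ n, DefinableSet (S n)) : DefinableSet (fun M _ R => ⋂ n, S n M R) := by
  choose φ hφ using h
  exact ⟨.conj φ, fun M _ R v => (forall_congr' fun n => hφ n M R v).trans Set.mem_iInter.symm⟩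

theorem iUnion {S : ℕ → ∀ (M : Type u) [Group M], (ℕ → Set M) → Set M}
    (h : ∀ n, DefinableSet (S n)) : DefinableSet (fun M _ R => ⋃ n, S n M R) := by
  simpa only [Set.compl_iInter, compl_compl] using (iInter fun n => (h n).compl).compl

theorem mul (h : DefinableSet S) (h' : DefinableSet S') :
    DefinableSet (fun M _ R => S M R * S' M R) := by
  obtain ⟨φ, hφ⟩ := h
  obtain ⟨ψ, hψ⟩ := h'
  -- Variable 0 is the free one; the two quantifiers bind 1 and 2, which stand for the factors.
  refine ⟨.ex (.ex (.and (φ.rename ![1]) (.and (ψ.rename ![2])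
    (.equal (mulTerm (.var 1) (.var 2)) (.var 0))))), fun M _ R v => ?_⟩
  simp only [Holds] at hφ hψ
  simp only [Holds, InfFormula.realize_ex, InfFormula.realize_and, InfFormula.realize_rename, hφ,
    hψ, InfFormula.Realize, realize_mulTerm, Term.realize, Set.mem_mul]
  constructor
  · rintro ⟨x, y, hx, hy, h⟩
    exact ⟨x, hx, y, hy, h⟩
  · rintro ⟨x, hx, y, hy, h⟩
    exact ⟨x, y, hx, hy, h⟩

theorem inv (h : DefinableSet S) : DefinableSet (fun M _ R => (S M R)⁻¹) := by
  obtain ⟨φ, hφ⟩ := h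
  refine ⟨.ex (.and (φ.rename ![1]) (.equal (invTerm (.var 1)) (.var 0))), fun M _ R v => ?_⟩
  simp only [Holds] at hφ
  simp only [Holds, InfFormula.realize_ex, InfFormula.realize_and, InfFormula.realize_rename, hφ,
    InfFormula.Realize, realize_invTerm, Term.realize]
  constructor
  · rintro ⟨x, hx, h⟩
    have h : x⁻¹ = v 0 := h
    have hx : x ∈ S M R := hx
    rwa [← h, Set.inv_mem_inv]
  · intro h
    exact ⟨(v 0)⁻¹, h, inv_inv (v 0)⟩

theorem pow (h : DefinableSet S) (n : ℕ) : DefinableSet (fun M _ R => S M R ^ n) := by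
  induction n with
  | zero => simpa only [pow_zero] using one
  | succ n ih => simpa only [pow_succ] using ih.mul h

end DefinableSet

namespace DefinableProp

variable {P P' : ∀ (M : Type u) [Group M], (ℕ → Set M) → Prop}
  {S S' : ∀ (M : Type u) [Group M], (ℕ → Set M) → Set M}

theorem eq_univ (h : DefinableSet S) : DefinableProp (fun M _ R => S M R = Set.univ) := by
  obtain ⟨φ, hφ⟩ := h
  refine ⟨.all φ, fun M _ R v => ?_⟩
  simp only [Holds] at hφ
  simp only [Holds, InfFormula.Realize, hφ, Set.eq_univ_iff_forall]
  exact Iff.rfl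

theorem not (h : DefinableProp P) : DefinableProp (fun M _ R => ¬ P M R) := by
  obtain ⟨φ, hφ⟩ := h
  exact ⟨φ.neg, fun M _ R v => not_congr (hφ M R v)⟩

theorem and (h : DefinableProp P) (h' : DefinableProp P') :
    DefinableProp (fun M _ R => P M R ∧ P' M R) := by
  obtain ⟨φ, hφ⟩ := h
  obtain ⟨ψ, hψ⟩ := h'
  exact ⟨φ.and ψ, fun M _ R v =>
    (holds_and R φ ψ v).trans (and_congr (hφ M R v) (hψ M R v))⟩

theorem or (h : DefinableProp P) (h' : DefinableProp P') :
    DefinableProp (fun M _ R => P M R ∨ P' M R) := by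
  simpa only [not_and_or, not_not] using (h.not.and h'.not).not

theorem forall_nat {P : ℕ → ∀ (M : Type u) [Group M], (ℕ → Set M) → Prop}
    (h : ∀ n, DefinableProp (P n)) : DefinableProp (fun M _ R => ∀ n, P n M R) := by
  choose φ hφ using h
  exact ⟨.conj φ, fun M _ R v => forall_congr' fun n => hφ n M R v⟩

/-- Conjunctions are indexed by `ℕ`, so another countable index type is enumerated, possibly with
repetitions. -/
theorem forall_countable {ι : Type} [Countable ι] [Nonempty ι]
    {P : ι → ∀ (M : Type u) [Group M], (ℕ → Set M) → Prop}
    (h : ∀ i, DefinableProp (P i)) : DefinableProp (fun M _ R => ∀ i, P i M R) := by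
  obtain ⟨f, hf⟩ := exists_surjective_nat ι
  simpa only [hf.forall] using forall_nat fun n => h (f n)

theorem subset (h : DefinableSet S) (h' : DefinableSet S') :
    DefinableProp (fun M _ R => S M R ⊆ S' M R) := by
  simpa only [Set.eq_univ_iff_forall, Set.mem_union, Set.mem_compl_iff, ← imp_iff_not_or,
    ← Set.subset_def] using eq_univ (h.compl.union h')

theorem disjoint (h : DefinableSet S) (h' : DefinableSet S') :
    DefinableProp (fun M _ R => Disjoint (S M R) (S' M R)) := by
  simpa only [← Set.subset_compl_iff_disjoint_right] using subset h h'.compl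

/-- The set underlies a subgroup. -/
theorem subgroup (h : DefinableSet S) :
    DefinableProp (fun M _ R => ∃ H : Subgroup M, (H : Set M) = S M R) := by
  have : DefinableProp (fun M _ R => (1 : Set M) ⊆ S M R ∧
      S M R * S M R ⊆ S M R ∧ (S M R)⁻¹ ⊆ S M R) :=
    (subset .one h).and ((subset (h.mul h) h).and (subset h.inv h))
  convert this using 4 with M _ R
  constructor
  · rintro ⟨H, hH⟩
    rw [← hH]
    simp
  · rintro ⟨h₁, h₂, h₃⟩
    exact ⟨{ carrier := S M R
             one_mem' := h₁ rfl
             mul_mem' := fun ha hb => h₂ (Set.mul_mem_mul ha hb)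
             inv_mem' := fun ha => h₃ (Set.inv_mem_inv.2 ha) }, rfl⟩

end DefinableProp

/-- The groups of the class are those that can be expanded by a sequence of subsets satisfying
some fixed sentence. -/
def IsPredicateReduct (K : ∀ (G : Type u) [Group G], Prop) : Prop :=
  ∃ P : ∀ (M : Type u) [Group M], (ℕ → Set M) → Prop, DefinableProp P ∧
    ∀ (M : Type u) [Group M], K M ↔ ∃ R, P M R

theorem IsPredicateReduct.or {K K' : ∀ (G : Type u) [Group G], Prop} (h : IsPredicateReduct K)
    (h' : IsPredicateReduct K') : IsPredicateReduct (fun G _ => K G ∨ K' G) := by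
  obtain ⟨P, hP, hK⟩ := h
  obtain ⟨P', hP', hK'⟩ := h'
  exact ⟨_, hP.or hP', fun M _ => by simp only [hK, hK', exists_or]⟩

theorem IsPredicateReduct.isReductOfAxiomatizable {K : ∀ (G : Type u) [Group G], Prop}
    (h : IsPredicateReduct K) : IsReductOfAxiomatizable K := by
  obtain ⟨P, ⟨φ, hφ⟩, hK⟩ := h
  refine ⟨predLang, insert φ groupAxioms, inferInstance, ?_, fun M S => ?_⟩
  · exact Set.Countable.insert _ (((Set.countable_singleton _).insert _).insert _)
  constructor
  · rintro ⟨S', hS'⟩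
    obtain ⟨_, rfl⟩ := (isModel_groupAxioms_iff S).1 fun ψ hψ => hS' ψ (Set.mem_insert_of_mem _ hψ)
    obtain ⟨R, rfl⟩ := exists_predStructure_eq S'
    exact ⟨_, rfl, (hK M).2 ⟨R, (hφ M R _).1 (hS' φ (Set.mem_insert _ _))⟩⟩
  · rintro ⟨_, rfl, hM⟩
    obtain ⟨R, hR⟩ := (hK M).1 hM
    let _ := predStructure R
    let _ := groupStructure M
    refine ⟨predStructure R, ?_⟩
    rintro ψ (rfl | hψ)
    · exact (hφ M R _).2 hR
    · exact (isModel_groupAxioms_iff _).2 ⟨_, rfl⟩ ψ hψ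

/-! ### The downward Löwenheim–Skolem theorem -/

/-- The language with the given finitary operations on `X` as function symbols. -/
def opLang {X : Type u} (F : Set (Σ n : ℕ, (Fin n → X) → X)) : FirstOrder.Language.{u, 0} where
  Functions := fun n => {f : (Fin n → X) → X // (⟨n, f⟩ : Σ n : ℕ, (Fin n → X) → X) ∈ F}
  Relations := fun _ => Empty

/-- An infinite set can be closed under countably many finitary operations without changing its
cardinality. -/
theorem exists_closed_superset {X : Type u} {F : Set (Σ n : ℕ, (Fin n → X) → X)}
    (hF : F.Countable) (A : Set X) [Infinite A] :
    ∃ B : Set X, A ⊆ B ∧ #B = #A ∧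
      ∀ (n : ℕ) (f : (Fin n → X) → X), ⟨n, f⟩ ∈ F → ∀ v : Fin n → X, (∀ i, v i ∈ B) → f v ∈ B := by
  let _ : (opLang F).Structure X :=
    { funMap := fun {n} f => f.1
      RelMap := fun {n} r => Empty.elim r }
  have hc : #(Σ n, (opLang F).Functions n) ≤ ℵ₀ := by
    have := hF.to_subtype
    have hi : Function.Injective
        (fun p : (Σ n, (opLang F).Functions n) => (⟨⟨p.1, p.2.1⟩, p.2.2⟩ : F)) := by
      rintro ⟨n, f, hf⟩ ⟨m, g, hg⟩ h
      simp only [Subtype.mk.injEq, Sigma.mk.injEq] at h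
      obtain ⟨rfl, h⟩ := h
      obtain rfl := eq_of_heq h
      rfl
    exact (mk_le_of_injective hi).trans (mk_le_aleph0_iff.2 inferInstance)
  refine ⟨Substructure.closure (opLang F) A, Substructure.subset_closure, le_antisymm ?_ ?_, ?_⟩
  · have h := Substructure.lift_card_closure_le (L := opLang F) (s := A)
    simp only [Cardinal.lift_id] at h
    have hA : ℵ₀ ≤ #A := aleph0_le_mk A
    exact h.trans (max_le hA (add_le_of_le hA le_rfl (hc.trans hA)))
  · exact mk_le_mk_of_subset Substructure.subset_closure
  · intro n f hf v hv
    exact (Substructure.closure (opLang F) A).fun_mem (⟨f, hf⟩ : (opLang F).Functions n) v hv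

namespace InfFormula

variable {L : FirstOrder.Language.{0, 0}}

/-- `N` contains witnesses for the failing universal subformulas of `φ`. -/
def HasWitnesses {M : Type u} [L.Structure M] (N : Set M) : {n : ℕ} → InfFormula L n → Prop
  | _, .falsum => True
  | _, .equal _ _ => True
  | _, .rel _ _ => True
  | _, .imp φ ψ => φ.HasWitnesses N ∧ ψ.HasWitnesses N
  | n, .all φ => φ.HasWitnesses N ∧ ∀ v : Fin n → M, (∀ i, v i ∈ N) →
      (∀ x ∈ N, φ.Realize (Fin.snoc v x)) → ∀ x, φ.Realize (Fin.snoc v x)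
  | _, .conj φ => ∀ k, (φ k).HasWitnesses N

/-- The Tarski–Vaught test, needed only for the subformulas of `φ`: `HasWitnesses` is what lifts a
universal statement from the range of `e` to all of `M`. -/
theorem realize_comp_embedding {M N : Type u} [L.Structure M] [L.Structure N] (e : N ↪[L] M)
    {n : ℕ} (φ : InfFormula L n) (h : φ.HasWitnesses (Set.range e)) (v : Fin n → N) :
    φ.Realize (e ∘ v) ↔ φ.Realize v := by
  induction φ with
  | falsum => rfl
  | equal t₁ t₂ => simp [Realize]
  | rel R ts =>
    simp only [Realize, HomClass.realize_term]
    exact e.map_rel R _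
  | imp φ ψ ih₁ ih₂ => simp only [Realize, ih₁ h.1, ih₂ h.2]
  | all φ ih =>
    have hs (x : N) : φ.Realize (Fin.snoc (e ∘ v) (e x)) ↔ φ.Realize (Fin.snoc v x) := by
      rw [← ih h.1, Fin.comp_snoc]
    refine ⟨fun H x => (hs x).1 (H (e x)), fun H => h.2 _ (fun i => ⟨v i, rfl⟩) ?_⟩
    rintro _ ⟨x, rfl⟩
    exact (hs x).2 (H x)
  | conj φ ih => exact forall_congr' fun k => ih k (h k) v

/-- The Skolem functions of the subformulas of `φ`. -/
def skolems {M : Type u} [L.Structure M] [Nonempty M] :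
    {n : ℕ} → InfFormula L n → Set (Σ n : ℕ, (Fin n → M) → M)
  | _, .falsum => ∅
  | _, .equal _ _ => ∅
  | _, .rel _ _ => ∅
  | _, .imp φ ψ => φ.skolems ∪ ψ.skolems
  | n, .all φ => insert
      ⟨n, fun v => Classical.epsilon fun x => ¬ φ.Realize (Fin.snoc v x)⟩ φ.skolems
  | _, .conj φ => ⋃ k, (φ k).skolems

/-- Only quantifiers contribute functions, and the branching at conjunctions is countable. -/
theorem countable_skolems {M : Type u} [L.Structure M] [Nonempty M] {n : ℕ}
    (φ : InfFormula L n) : (φ.skolems (M := M)).Countable := by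
  induction φ with
  | falsum | equal | rel => exact Set.countable_empty
  | imp φ ψ ih₁ ih₂ => exact ih₁.union ih₂
  | all φ ih => exact ih.insert _
  | conj φ ih => exact Set.countable_iUnion ih

theorem hasWitnesses_of_closed {M : Type u} [L.Structure M] [Nonempty M] {n : ℕ}
    (φ : InfFormula L n) (N : Set M) (h : ∀ (n : ℕ) (f : (Fin n → M) → M), ⟨n, f⟩ ∈ φ.skolems →
      ∀ v : Fin n → M, (∀ i, v i ∈ N) → f v ∈ N) : φ.HasWitnesses N := by
  induction φ with
  | falsum | equal | rel => exact trivial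
  | imp φ ψ ih₁ ih₂ =>
    exact ⟨ih₁ fun n f hf => h n f (Or.inl hf), ih₂ fun n f hf => h n f (Or.inr hf)⟩
  | @all n φ ih =>
    refine ⟨ih fun n f hf => h n f (Or.inr hf), fun v hv H x => ?_⟩
    by_contra hx
    -- The Skolem function picks a counterexample as soon as there is one, and closure puts it into
    -- `N`, where `H` excludes counterexamples.
    exact Classical.epsilon_spec (p := fun x => ¬ φ.Realize (Fin.snoc v x)) ⟨x, hx⟩
      (H _ (h n _ (Or.inl rfl) v hv))
  | conj φ ih => exact fun k => ih k fun n f hf => h n f (Set.mem_iUnion.2 ⟨k, hf⟩)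

end InfFormula

/-- The axiomatization only provides some group structure inducing the given interpretation of the
symbols; this identifies it with the one inherited from the ambient group. -/
theorem groupStructure_injective {M : Type u} {i₁ i₂ : Group M}
    (h : @groupStructure M i₁ = @groupStructure M i₂) : i₁ = i₂ := by
  refine Group.ext ?_
  funext a b
  have := congrArg (fun S : groupLang.Structure M =>
    S.funMap (GroupFunc.mul : groupLang.Functions 2) ![a, b]) h
  exact this

theorem IsReductOfAxiomatizable.isBountiful {K : ∀ (G : Type u) [Group G], Prop}
    (hK : IsReductOfAxiomatizable K) : IsBountiful K := by
  obtain ⟨L, T, hL, hT, h⟩ := hK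
  intro H _ hH G _
  let _ := groupStructure H
  obtain ⟨S, hS⟩ := (h H (groupStructure H)).2 ⟨_, rfl, hH⟩
  -- Closure under the operations gives a substructure, hence a subgroup; closure under the Skolem
  -- functions makes it a model of `T`.
  let F : Set (Σ n : ℕ, (Fin n → H) → H) :=
    Set.range (fun p : Σ n, (groupLang.sum L).Functions n => ⟨p.1, Structure.funMap p.2⟩) ∪
      ⋃ φ ∈ T, φ.skolems
  have hc : Countable (Σ n, (groupLang.sum L).Functions n) := by
    have h₁ (n : ℕ) : Countable (groupLang.Functions n) := sigma_mk_injective.countable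
    have h₂ (n : ℕ) : Countable (L.Functions n) := sigma_mk_injective.countable
    have (n : ℕ) : Countable ((groupLang.sum L).Functions n) :=
      inferInstanceAs (Countable (groupLang.Functions n ⊕ L.Functions n))
    infer_instance
  have hF : F.Countable :=
    (Set.countable_range _).union (hT.biUnion fun φ _ => φ.countable_skolems)
  have : Infinite (G : Set H) := ‹Infinite G›
  obtain ⟨B, hGB, hcard, hB⟩ := exists_closed_superset hF (G : Set H)
  have hfun {n : ℕ} (f : (groupLang.sum L).Functions n) (v : Fin n → H) (hv : ∀ i, v i ∈ B) :
      Structure.funMap f v ∈ B := hB _ _ (Or.inl ⟨⟨n, f⟩, rfl⟩) v hv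
  let N : Subgroup H :=
    { carrier := B
      one_mem' := hGB G.one_mem
      mul_mem' := fun {a b} ha hb => hfun (Sum.inl GroupFunc.mul : (groupLang.sum L).Functions 2)
        ![a, b] (Fin.forall_fin_two.2 ⟨ha, hb⟩)
      inv_mem' := fun {a} ha => hfun (Sum.inl GroupFunc.inv : (groupLang.sum L).Functions 1)
        ![a] (Fin.forall_fin_one.2 ha) }
  refine ⟨N, hGB, ?_, hcard⟩
  let _ : L.Structure N :=
    { funMap := fun {n} f v => ⟨S.funMap f fun i => (v i : H),
        hfun (Sum.inr f : (groupLang.sum L).Functions n) _ fun i => (v i).2⟩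
      RelMap := fun {n} r v => S.RelMap r fun i => (v i : H) }
  let _ := groupStructure N
  let e : N ↪[groupLang.sum L] H :=
    { toFun := Subtype.val
      inj' := Subtype.val_injective
      map_fun' := by
        rintro n (f | f) x
        · cases f <;> rfl
        · rfl
      map_rel' := by
        rintro n (r | r) x
        · exact Empty.elim r
        · exact Iff.rfl }
  have hN : IsModel T N := by
    intro φ hφ
    rw [← InfFormula.realize_comp_embedding e φ]
    · convert hS φ hφ
    · have : Set.range e = B := Subtype.range_val
      rw [this]
      exact φ.hasWitnesses_of_closed B fun n f hf =>
        hB n f (Or.inr (Set.mem_biUnion hφ hf))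
  obtain ⟨i, hi, hKN⟩ := (h N (groupStructure N)).1 ⟨_, hN⟩
  obtain rfl := groupStructure_injective hi
  exact hKN

/-! ### Generating sets -/

/-- The symmetric subset `U ∪ U⁻¹ ∪ {1}`. -/
def symmSet {G : Type u} [Group G] (U : Set G) : Set G := U ∪ U⁻¹ ∪ {1}

theorem inv_symmSet {G : Type u} [Group G] (U : Set G) : (symmSet U)⁻¹ = symmSet U := by
  simp [symmSet, Set.union_inv, Set.union_comm]

/-- The right-hand side is a countable union of definable sets, which is how generation becomes an
$L_{\omega_1\omega}$-property. -/
theorem closure_eq_top_iff_iUnion_pow {G : Type u} [Group G] (U : Set G) :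
    Subgroup.closure U = ⊤ ↔ ⋃ n : ℕ, symmSet U ^ n = Set.univ := by
  constructor
  · intro h
    refine Set.eq_univ_iff_forall.2 fun x => ?_
    have hx : x ∈ Subgroup.closure U := h ▸ Subgroup.mem_top x
    simp only [Set.mem_iUnion]
    induction hx using Subgroup.closure_induction with
    | mem x hx => exact ⟨1, by simp [symmSet, hx]⟩
    | one => exact ⟨0, by simp⟩
    | mul x y _ _ hx hy =>
      obtain ⟨n, hn⟩ := hx
      obtain ⟨m, hm⟩ := hy
      exact ⟨n + m, by rw [pow_add]; exact Set.mul_mem_mul hn hm⟩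
    | inv x _ hx =>
      obtain ⟨n, hn⟩ := hx
      exact ⟨n, by rw [← inv_symmSet, inv_pow]; exact Set.inv_mem_inv.2 hn⟩
  · intro h
    have hS : symmSet U ⊆ Subgroup.closure U := by
      rintro x ((hx | hx) | rfl)
      · exact Subgroup.subset_closure hx
      · exact inv_mem_iff.1 (Subgroup.subset_closure hx)
      · exact one_mem _
    have hp (n : ℕ) : symmSet U ^ n ⊆ Subgroup.closure U := by
      induction n with
      | zero => simp
      | succ n ih =>
        rw [pow_succ]
        rintro _ ⟨a, ha, b, hb, rfl⟩
        exact mul_mem (ih ha) (hS hb)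
    refine eq_top_iff.2 fun x _ => ?_
    obtain ⟨n, hn⟩ := Set.mem_iUnion.1 (Set.eq_univ_iff_forall.1 h x)
    exact hp n hn

theorem DefinableSet.symmSet {S : ∀ (M : Type u) [Group M], (ℕ → Set M) → Set M}
    (h : DefinableSet S) : DefinableSet (fun M _ R => symmSet (S M R)) := by
  simpa only [GroupClass.symmSet, Set.singleton_one] using (h.union h.inv).union .one

/-- The sentence saying that a definable set generates the group. -/
theorem DefinableProp.closure_eq_top {S : ∀ (M : Type u) [Group M], (ℕ → Set M) → Set M}
    (h : DefinableSet S) : DefinableProp (fun M _ R => Subgroup.closure (S M R) = ⊤) := by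
  simpa only [closure_eq_top_iff_iUnion_pow] using eq_univ (.iUnion fun n => h.symmSet.pow n)

/-! ### Groups that are not Cayley bounded, and groups of countable cofinality -/

theorem isPredicateReduct_not_isCayleyBounded :
    IsPredicateReduct.{u} (fun G _ => ¬ IsCayleyBounded G) := by
  refine ⟨_, (DefinableProp.closure_eq_top (.symbol 0)).and
    (.forall_nat fun n => (DefinableProp.eq_univ ((DefinableSet.symbol 0).symmSet.pow n)).not),
    fun G _ => ?_⟩
  simp only [IsCayleyBounded, not_forall, not_exists, Set.eq_univ_iff_forall, symmSet]
  constructor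
  · rintro ⟨U, hU, h⟩
    exact ⟨fun _ => U, hU, h⟩
  · rintro ⟨R, hU, h⟩
    exact ⟨R 0, hU, h⟩

theorem isPredicateReduct_hasCofinalityLeOmega :
    IsPredicateReduct.{u} (fun G _ => HasCofinalityLeOmega G) := by
  refine ⟨_, (DefinableProp.forall_nat fun n => .subgroup (.symbol n)).and
    ((DefinableProp.forall_nat fun n => .subset (.symbol n) (.symbol (n + 1))).and
      ((DefinableProp.forall_nat fun n =>
        (DefinableProp.subset (.symbol (n + 1)) (.symbol n)).not).and
        (.eq_univ (.iUnion fun n => .symbol n)))), fun G _ => ?_⟩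
  constructor
  · rintro ⟨H, hH, -, hU⟩
    refine ⟨fun n => H n, fun n => ⟨H n, rfl⟩, fun n => hH.monotone n.le_succ,
      fun n h => (hH n.lt_succ_self).not_ge h, ?_⟩
    simpa [Set.eq_univ_iff_forall] using hU
  · rintro ⟨R, hR, hle, hne, hU⟩
    choose H hH using hR
    obtain rfl : (fun n => (H n : Set G)) = R := funext hH
    have hm : StrictMono H := strictMono_nat_of_lt_succ fun n => lt_of_le_not_ge (hle n) (hne n)
    refine ⟨H, hm, fun n h => ?_, by simpa [Set.eq_univ_iff_forall] using hU⟩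
    -- Properness needs no axiom of its own: `H n` lies strictly below `H (n + 1)`.
    exact not_top_lt (h ▸ hm n.lt_succ_self)

theorem isPredicateReduct_not_isStronglyBounded :
    IsPredicateReduct.{u} (fun G _ => ¬ IsStronglyBounded G) := by
  simpa only [IsStronglyBounded, not_and_or, not_not] using
    isPredicateReduct_not_isCayleyBounded.{u}.or isPredicateReduct_hasCofinalityLeOmega.{u}

/-! ### Groups that map onto the integers -/

/-- The sets `F n` are the fibres. Covering and disjointness make them the fibres of a function, the
product condition makes it a homomorphism, and powers of an element of `F 1` reach every integer. -/
theorem mapsOntoInt_iff (G : Type u) [Group G] : MapsOntoInt G ↔ ∃ F : ℤ → Set G,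
    (∀ p : ℤ × ℤ, F p.1 * F p.2 ⊆ F (p.1 + p.2)) ∧
    (∀ p : {p : ℤ × ℤ // p.1 ≠ p.2}, Disjoint (F p.1.1) (F p.1.2)) ∧
    (∀ x : G, ∃ n, x ∈ F n) ∧ (F 1).Nonempty := by
  constructor
  · rintro ⟨f, hf⟩
    refine ⟨fun n => {x | f x = Multiplicative.ofAdd n}, ?_, ?_, fun x => ⟨(f x).toAdd, rfl⟩,
      hf (Multiplicative.ofAdd 1)⟩
    · rintro ⟨n, m⟩ _ ⟨x, hx, y, hy, rfl⟩
      have hx : f x = Multiplicative.ofAdd n := hx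
      have hy : f y = Multiplicative.ofAdd m := hy
      simp [hx, hy, ofAdd_add]
    · rintro ⟨⟨n, m⟩, h⟩
      refine Set.disjoint_left.2 fun x hx hy => h ?_
      exact Multiplicative.ofAdd.injective (Eq.trans (Eq.symm hx) hy)
  · rintro ⟨F, hmul, hdisj, hF, x, hx⟩
    choose f hf using hF
    have huniq {x : G} {n m : ℤ} (hn : x ∈ F n) (hm : x ∈ F m) : n = m := by
      by_contra h
      exact Set.disjoint_left.1 (hdisj ⟨(n, m), h⟩) hn hm
    let φ : G →* Multiplicative ℤ := MonoidHom.mk' (fun x => Multiplicative.ofAdd (f x))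
      fun a b => congrArg Multiplicative.ofAdd
        (huniq (hf (a * b)) (hmul (f a, f b) (Set.mul_mem_mul (hf a) (hf b))))
    have hφ : φ x = Multiplicative.ofAdd 1 := congrArg Multiplicative.ofAdd (huniq (hf x) hx)
    refine ⟨φ, fun n => ⟨x ^ n.toAdd, ?_⟩⟩
    rw [map_zpow, hφ, ← ofAdd_zsmul, zsmul_one]
    simp

theorem isPredicateReduct_mapsOntoInt :
    IsPredicateReduct.{u} (fun G _ => MapsOntoInt G) := by
  have : Nonempty {p : ℤ × ℤ // p.1 ≠ p.2} := ⟨⟨(0, 1), by decide⟩⟩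
  let e := Equiv.intEquivNat
  refine ⟨_, (DefinableProp.forall_countable fun p : ℤ × ℤ =>
      .subset ((DefinableSet.symbol (e p.1)).mul (.symbol (e p.2))) (.symbol (e (p.1 + p.2)))).and
    ((DefinableProp.forall_countable fun p : {p : ℤ × ℤ // p.1 ≠ p.2} =>
      .disjoint (.symbol (e p.1.1)) (.symbol (e p.1.2))).and
      ((DefinableProp.eq_univ (.iUnion fun n => .symbol n)).and
        -- Nonemptiness of the fibre over 1, stated as its complement not being everything.
        (DefinableProp.eq_univ (DefinableSet.symbol (e 1)).compl).not)), fun G _ => ?_⟩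
  refine (mapsOntoInt_iff G).trans ?_
  simp only [Set.eq_univ_iff_forall, Set.mem_iUnion, Set.mem_compl_iff, not_forall, not_not]
  constructor
  · rintro ⟨F, h₁, h₂, h₃, h₄⟩
    refine ⟨fun n => F (e.symm n), ?_⟩
    simp only [Equiv.symm_apply_apply]
    exact ⟨h₁, h₂, fun x => e.symm.surjective.exists.1 (h₃ x), h₄⟩
  · rintro ⟨R, h₁, h₂, h₃, h₄⟩
    exact ⟨fun n => R (e n), h₁, h₂, fun x => e.surjective.exists.1 (h₃ x), h₄⟩

/-! ### Groups without property FA -/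

/-- Acyclicity passes to induced subgraphs, so only connectedness is at stake; one fixed walk for
each pair of vertices, not necessarily a path, suffices. -/
theorem isTree_induce_of_getVert_mem {V : Type u} {X : SimpleGraph V} (hX : X.IsTree) {W : Set V}
    (hW : W.Nonempty) (p : ∀ v w : V, X.Walk v w)
    (hp : ∀ v ∈ W, ∀ w ∈ W, ∀ k : ℕ, (p v w).getVert k ∈ W) : (X.induce W).IsTree := by
  have := hW.to_subtype
  refine ⟨⟨?_⟩, hX.isAcyclic.induce W⟩
  rintro ⟨v, hv⟩ ⟨w, hw⟩
  refine ⟨(p v w).induce W fun x hx => ?_⟩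
  obtain ⟨k, rfl, -⟩ := SimpleGraph.Walk.mem_support_iff_exists_getVert.1 hx
  exact hp v hv w hw k

/-- The action of a subgroup on an invariant induced subgraph. -/
def inducedAction {H : Type u} [Group H] {V : Type u} {X : SimpleGraph V} (ρ : H →* (X ≃g X))
    (N : Subgroup H) (W : Set V) (hW : ∀ h ∈ N, ∀ v ∈ W, ρ h v ∈ W) :
    N →* (X.induce W ≃g X.induce W) where
  toFun h :=
    { toFun := fun v => ⟨ρ h v, hW h h.2 v v.2⟩
      invFun := fun v => ⟨ρ (h⁻¹ : N) v, hW _ (h⁻¹).2 v v.2⟩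
      left_inv := fun v => Subtype.ext <| by
        change (ρ (h⁻¹ : N) * ρ h) v = v
        rw [← map_mul]
        simp
      right_inv := fun v => Subtype.ext <| by
        change (ρ h * ρ (h⁻¹ : N)) v = v
        rw [← map_mul]
        simp
      map_rel_iff' := (ρ h).map_rel_iff' }
  map_one' := by ext v; simp
  map_mul' g h := by ext v; simp

/-- Fix a tree action without fixed point, and for each vertex and each edge a group element moving
it. Closing `G` and one vertex under these choices, the action and the chosen walks yields a
subgroup `N` acting on a subtree, and every vertex or edge of the subtree is moved by an element of
`N`. -/
theorem isBountiful_not_hasFA : IsBountiful.{u} (fun G _ => ¬ HasFA G) := by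
  intro H _ hH G _
  simp only [HasFA, not_forall, not_or, not_exists, not_and] at hH
  obtain ⟨V, X, hX, ρ, hv, he⟩ := hH
  choose mv hmv using hv
  choose me hme using he
  classical
  obtain ⟨v₀⟩ := hX.connected.nonempty
  let p (v w : V) : X.Walk v w := (hX.connected v w).some
  -- Two-sorted operations coded on `H ⊕ V`: product, inverse, action, movers of vertices, movers of
  -- edges, and the `k`-th vertices of the chosen walks. Arguments of the wrong sort, or
  -- non-adjacent vertices for the edge movers, give the default value 1.
  let F : Set (Σ n : ℕ, (Fin n → H ⊕ V) → H ⊕ V) :=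
    {⟨2, fun x => match x 0, x 1 with | .inl a, .inl b => .inl (a * b) | _, _ => .inl 1⟩,
      ⟨1, fun x => match x 0 with | .inl a => .inl a⁻¹ | _ => .inl 1⟩,
      ⟨2, fun x => match x 0, x 1 with | .inl a, .inr v => .inr (ρ a v) | _, _ => .inl 1⟩,
      ⟨1, fun x => match x 0 with | .inr v => .inl (mv v) | _ => .inl 1⟩,
      ⟨2, fun x => match x 0, x 1 with
        | .inr v, .inr w => if h : X.Adj v w then .inl (me v w h) else .inl 1
        | _, _ => .inl 1⟩} ∪
    Set.range fun k : ℕ =>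
      ⟨2, fun x => match x 0, x 1 with | .inr v, .inr w => .inr ((p v w).getVert k) | _, _ => .inl 1⟩
  have hF : F.Countable := by
    refine Set.Countable.union ?_ (Set.countable_range _)
    exact (Set.toFinite _).countable
  -- The vertex `v₀` makes the subtree nonempty; one extra point does not change an infinite
  -- cardinality.
  let A : Set (H ⊕ V) := insert (.inr v₀) (Sum.inl '' (G : Set H))
  have : Infinite (Sum.inl '' (G : Set H) : Set (H ⊕ V)) :=
    (Set.infinite_coe_iff.1 ‹Infinite G›).image Sum.inl_injective.injOn |>.to_subtype
  have hA : #A = #G := by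
    rw [mk_insert (by simp), mk_image_eq Sum.inl_injective]
    exact add_one_eq (aleph0_le_mk G)
  have : Infinite A := infinite_iff.2 (hA ▸ aleph0_le_mk G)
  obtain ⟨B, hAB, hcard, hB⟩ := exists_closed_superset hF A
  have hmul {a b : H} (ha : .inl a ∈ B) (hb : .inl b ∈ B) : .inl (a * b) ∈ B :=
    hB 2 _ (Or.inl (Or.inl rfl)) ![.inl a, .inl b]
      (Fin.forall_fin_two.2 ⟨ha, hb⟩)
  have hinv {a : H} (ha : .inl a ∈ B) : .inl a⁻¹ ∈ B :=
    hB 1 _ (Or.inl (Or.inr (Or.inl rfl))) ![.inl a] (Fin.forall_fin_one.2 ha)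
  have hact {a : H} {v : V} (ha : .inl a ∈ B) (hv : .inr v ∈ B) : .inr (ρ a v) ∈ B :=
    hB 2 _ (Or.inl (Or.inr (Or.inr (Or.inl rfl)))) ![.inl a, .inr v]
      (Fin.forall_fin_two.2 ⟨ha, hv⟩)
  have hmvB {v : V} (hv : .inr v ∈ B) : .inl (mv v) ∈ B :=
    hB 1 _ (Or.inl (Or.inr (Or.inr (Or.inr (Or.inl rfl))))) ![.inr v] (Fin.forall_fin_one.2 hv)
  have hmeB {v w : V} (hv : .inr v ∈ B) (hw : .inr w ∈ B) (h : X.Adj v w) :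
      .inl (me v w h) ∈ B := by
    have := hB 2 _ (Or.inl (Or.inr (Or.inr (Or.inr (Or.inr rfl))))) ![.inr v, .inr w]
      (Fin.forall_fin_two.2 ⟨hv, hw⟩)
    simpa [h] using this
  have hpB {v w : V} (hv : .inr v ∈ B) (hw : .inr w ∈ B) (k : ℕ) :
      .inr ((p v w).getVert k) ∈ B :=
    hB 2 _ (Or.inr ⟨k, rfl⟩) ![.inr v, .inr w] (Fin.forall_fin_two.2 ⟨hv, hw⟩)
  have hGB {g : H} (hg : g ∈ G) : .inl g ∈ B := hAB (Or.inr ⟨g, hg, rfl⟩)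
  let N : Subgroup H :=
    { carrier := (Sum.inl : H → H ⊕ V) ⁻¹' B
      one_mem' := hGB G.one_mem
      mul_mem' := hmul
      inv_mem' := hinv }
  let W : Set V := (Sum.inr : V → H ⊕ V) ⁻¹' B
  refine ⟨N, fun g hg => hGB hg, ?_, le_antisymm ?_ ?_⟩
  · intro hFA
    have hW : ∀ h ∈ N, ∀ v ∈ W, ρ h v ∈ W := fun h hh v hv => hact hh hv
    have hT : (X.induce W).IsTree := isTree_induce_of_getVert_mem hX
      ⟨v₀, hAB (Or.inl rfl)⟩ p fun v hv w hw k => hpB hv hw k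
    rcases hFA W (X.induce W) hT (inducedAction ρ N W hW) with ⟨v, h⟩ | ⟨v, w, hvw, h⟩
    · exact hmv v (congrArg Subtype.val (h ⟨mv v, hmvB v.2⟩))
    · refine hme v w hvw ?_
      exact congrArg (Sym2.map Subtype.val) (h ⟨me v w hvw, hmeB v.2 w.2 hvw⟩)
  · rw [← hA, ← hcard]
    exact mk_le_of_injective (f := fun h : N => (⟨.inl h, h.2⟩ : B)) fun a b h =>
      Subtype.ext (Sum.inl_injective (congrArg Subtype.val h))
  · exact mk_le_mk_of_subset fun g hg => hGB hg


/-! ### Amalgamated free products -/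

section Amalgam

variable {G : Type u} [Group G]

theorem ne_rev_fin_two (i : Fin 2) : i ≠ i.rev := by
  revert i; decide

/-- Products of `n + 1` elements taken alternately from `A i \ A i.rev` and `A i.rev \ A i`. -/
def alternatingProducts (A : Fin 2 → Set G) : ℕ → Fin 2 → Set G
  | 0, i => A i \ A i.rev
  | n + 1, i => (A i \ A i.rev) * alternatingProducts A n i.rev

/-- The group is the free product of its subgroups `A 0` and `A 1` with amalgamated intersection,
which is properly contained in both of them. -/
def IsInternalAmalgam (A : Fin 2 → Subgroup G) : Prop :=
  (∀ i, ¬ (A i : Set G) ⊆ A i.rev) ∧ Subgroup.closure ((A 0 : Set G) ∪ A 1) = ⊤ ∧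
    ∀ n i, Disjoint (alternatingProducts (fun i => (A i : Set G)) n i) ((A 0 : Set G) ∩ A 1)

theorem mem_zero_one_iff (A : Fin 2 → Subgroup G) (i : Fin 2) (x : G) :
    x ∈ (A 0 : Set G) ∩ A 1 ↔ x ∈ A i ∧ x ∈ A i.rev := by
  fin_cases i
  · rfl
  · exact and_comm

open Monoid Monoid.PushoutI

/-- In the pushout the two factors meet exactly in the base group, so an alternating product is the
value of a nonempty reduced word; by the normal form theorem such a value is not in the base group.
-/
theorem isInternalAmalgam_of_mulEquiv {C : Type u} [Group C] {A : Fin 2 → Type u}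
    [∀ i, Group (A i)] {φ : ∀ i, C →* A i} (hφ : ∀ i, Function.Injective (φ i))
    (hφ' : ∀ i, ¬ Function.Surjective (φ i)) (e : G ≃* PushoutI φ) :
    IsInternalAmalgam fun i => (of (φ := φ) i).range.comap e.toMonoidHom := by
  have hC (i : Fin 2) (x : G) (h : e x ∈ (of (φ := φ) i).range)
      (h' : e x ∈ (of (φ := φ) i.rev).range) : e x ∈ (base φ).range := by
    rw [← inf_of_range_eq_base_range hφ (ne_rev_fin_two i)]
    exact ⟨h, h'⟩
  have hbase (i : Fin 2) (a : A i) : of i a ∈ (base φ).range ↔ a ∈ (φ i).range := by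
    constructor
    · rintro ⟨c, hc⟩
      rw [← of_apply_eq_base φ i] at hc
      exact ⟨c, of_injective hφ i hc⟩
    · rintro ⟨c, rfl⟩
      exact ⟨c, (of_apply_eq_base φ i c).symm⟩
  have hle (i : Fin 2) : (base φ).range ≤ (of (φ := φ) i).range := by
    rintro _ ⟨c, rfl⟩
    exact ⟨φ i c, of_apply_eq_base φ i c⟩
  refine ⟨fun i h => hφ' i fun a => ?_, eq_top_iff.2 fun x _ => ?_, fun n i => ?_⟩
  · have ha : e (e.symm (of i a)) ∈ (of (φ := φ) i).range := by simp
    have := hC i _ ha (h ha)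
    rw [e.apply_symm_apply, hbase] at this
    exact this
  · obtain ⟨y, rfl⟩ := e.symm.surjective x
    have hof (i : Fin 2) (a : A i) : e.symm (of i a) ∈ Subgroup.closure
        (((of (φ := φ) 0).range.comap e.toMonoidHom : Set G) ∪
          (of (φ := φ) 1).range.comap e.toMonoidHom) := by
      refine Subgroup.subset_closure ?_
      fin_cases i
      · exact Or.inl ⟨a, (e.apply_symm_apply _).symm⟩
      · exact Or.inr ⟨a, (e.apply_symm_apply _).symm⟩
    induction y using PushoutI.induction_on with
    | of i a => exact hof i a
    | base c => exact of_apply_eq_base φ 0 c ▸ hof 0 (φ 0 c)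
    | mul y z hy hz => rw [map_mul]; exact mul_mem (hy trivial) (hz trivial)
  · have hletter (i : Fin 2) (x : G)
        (h : x ∈ ((of (φ := φ) i).range.comap e.toMonoidHom : Set G) \
          (of (φ := φ) i.rev).range.comap e.toMonoidHom) :
        ∃ a : A i, a ∉ (φ i).range ∧ e x = of i a := by
      obtain ⟨⟨a, ha⟩, h'⟩ := h
      refine ⟨a, fun hr => h' ?_, ha.symm⟩
      have := hle i.rev ((hbase i a).2 hr)
      rw [ha] at this
      exact this
    have hword : ∀ x ∈ alternatingProducts
        (fun i => ((of (φ := φ) i).range.comap e.toMonoidHom : Set G)) n i,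
        ∃ w : CoprodI.Word A, Reduced φ w ∧ w.fstIdx = some i ∧ e x = ofCoprodI w.prod := by
      induction n generalizing i with
      | zero =>
        intro x hx
        obtain ⟨a, ha, hxa⟩ := hletter i x hx
        have h₀ : (CoprodI.Word.empty : CoprodI.Word A).fstIdx ≠ some i := Option.some_ne_none i |>.symm
        have h₁ : a ≠ 1 := fun h => ha (h ▸ one_mem _)
        refine ⟨CoprodI.Word.cons a .empty h₀ h₁, ?_, rfl, ?_⟩
        · simpa [Reduced, CoprodI.Word.cons, CoprodI.Word.empty] using ha
        · rw [hxa, CoprodI.Word.prod_cons, map_mul, ofCoprodI_of, CoprodI.Word.prod_empty, map_one,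
            mul_one]
      | succ n ih =>
        rintro _ ⟨x, hx, y, hy, rfl⟩
        obtain ⟨a, ha, hxa⟩ := hletter i x hx
        obtain ⟨w, hw, hwi, hyw⟩ := ih _ y hy
        refine ⟨CoprodI.Word.cons a w ?_ fun h => ha (h ▸ one_mem _), ?_, rfl, ?_⟩
        · simpa [hwi] using (ne_rev_fin_two i).symm
        · intro g hg
          rcases List.mem_cons.1 hg with rfl | hg
          · exact ha
          · exact hw g hg
        · rw [CoprodI.Word.prod_cons]
          simp [hxa, hyw]
    refine Set.disjoint_left.2 fun x hx hx' => ?_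
    obtain ⟨w, hw, hwi, hxw⟩ := hword x hx
    have := hw.eq_empty_of_mem_range hφ (hxw ▸ hC 0 x hx'.1 hx'.2)
    rw [this] at hwi
    simp [CoprodI.Word.fstIdx, CoprodI.Word.empty] at hwi

theorem exists_list_prod_mem_alternatingProducts (A : Fin 2 → Subgroup G) (i : Fin 2) (a : A i)
    (l : List (Σ i, A i)) (hc : (⟨i, a⟩ :: l : List (Σ i, A i)).IsChain fun p q => p.1 ≠ q.1)
    (hl : ∀ p ∈ (⟨i, a⟩ :: l : List (Σ i, A i)), (p.2 : G) ∉ A p.1.rev) :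
    ∃ n, ((⟨i, a⟩ :: l : List (Σ i, A i)).map fun p => (p.2 : G)).prod ∈
      alternatingProducts (fun i => (A i : Set G)) n i := by
  induction l generalizing i a with
  | nil => exact ⟨0, by simpa [alternatingProducts] using hl⟩
  | cons q l ih =>
    obtain ⟨j, b⟩ := q
    rw [List.isChain_cons_cons] at hc
    have hj : j = i.rev := by
      have : i ≠ j := hc.1
      clear * - this
      revert i j; decide
    obtain ⟨n, hn⟩ := ih j b hc.2 fun p hp => hl p (List.mem_cons_of_mem _ hp)
    refine ⟨n + 1, ?_⟩
    rw [List.map_cons, List.prod_cons]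
    exact Set.mul_mem_mul ⟨a.2, hl _ List.mem_cons_self⟩ (hj ▸ hn)

/-- Letters of a normal word are coset representatives different from 1, whereas the coset of the
amalgamated subgroup is represented by 1. -/
theorem notMem_range_of_mem_toList {ι : Type*} {A : ι → Type*} {C : Type*} [∀ i, Group (A i)]
    [Group C] {φ : ∀ i, C →* A i} {d : NormalWord.Transversal φ} (w : NormalWord d) {i : ι} {a : A i}
    (h : ⟨i, a⟩ ∈ w.toList) : a ∉ (φ i).range := by
  intro hr
  refine w.ne_one _ h ?_
  exact congrArg Subtype.val (((d.compl i).equiv_snd_eq_self_of_mem_of_one_mem (one_mem _)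
    (w.normalized i a h)).symm.trans
    ((d.compl i).equiv_snd_eq_one_of_mem_of_one_mem (d.one_mem i) hr))

/-- The inclusion of the intersection of two subgroups into each of them. -/
def interInclusion (A : Fin 2 → Subgroup G) (i : Fin 2) : (A 0 ⊓ A 1 : Subgroup G) →* A i :=
  Subgroup.inclusion fun _ hx => ((mem_zero_one_iff A i _).1 hx).1

theorem subtype_comp_interInclusion (A : Fin 2 → Subgroup G) (i : Fin 2) :
    (A i).subtype.comp (interInclusion A i) = (A 0 ⊓ A 1).subtype :=
  Subgroup.subtype_comp_inclusion _

/-- The canonical map from the amalgamated product of two subgroups to the group. -/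
def amalgamMap (A : Fin 2 → Subgroup G) : PushoutI (interInclusion A) →* G :=
  PushoutI.lift (fun i => (A i).subtype) (A 0 ⊓ A 1).subtype (subtype_comp_interInclusion A)

theorem amalgamMap_of (A : Fin 2 → Subgroup G) (i : Fin 2) (a : A i) :
    amalgamMap A (of i a) = a := by
  rw [amalgamMap, PushoutI.lift_of, Subgroup.coe_subtype]

theorem amalgamMap_base (A : Fin 2 → Subgroup G) (c : (A 0 ⊓ A 1 : Subgroup G)) :
    amalgamMap A (base _ c) = c := by
  rw [amalgamMap, PushoutI.lift_base, Subgroup.coe_subtype]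

theorem interInclusion_injective (A : Fin 2 → Subgroup G) (i : Fin 2) :
    Function.Injective (interInclusion A i) :=
  Subgroup.inclusion_injective _

theorem IsInternalAmalgam.amalgamMap_surjective {A : Fin 2 → Subgroup G}
    (h : IsInternalAmalgam A) : Function.Surjective (amalgamMap A) := by
  rw [← MonoidHom.range_eq_top, eq_top_iff, ← h.2.1, Subgroup.closure_le]
  rintro x (hx | hx)
  · exact ⟨of 0 ⟨x, hx⟩, amalgamMap_of A 0 ⟨x, hx⟩⟩
  · exact ⟨of 1 ⟨x, hx⟩, amalgamMap_of A 1 ⟨x, hx⟩⟩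

theorem amalgamMap_prod (A : Fin 2 → Subgroup G)
    {d : NormalWord.Transversal (interInclusion A)} (w : NormalWord d) :
    amalgamMap A w.prod = w.head * (w.toList.map fun p => (p.2 : G)).prod := by
  simp [amalgamMap_of, amalgamMap_base, NormalWord.prod, CoprodI.Word.prod, map_list_prod,
    Function.comp_def]

/-- Write an element of the kernel in normal form. If any letters are left after the head, they form
an alternating product equal to the inverse of the head, hence lying in the intersection, which is
excluded. -/
theorem IsInternalAmalgam.amalgamMap_injective {A : Fin 2 → Subgroup G}
    (h : IsInternalAmalgam A) : Function.Injective (amalgamMap A) := by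
  classical
  refine (injective_iff_map_eq_one _).2 fun x hx => ?_
  obtain ⟨d⟩ := NormalWord.transversal_nonempty _ (interInclusion_injective A)
  obtain ⟨w, rfl⟩ : ∃ w : NormalWord d, w.prod = x :=
    ⟨NormalWord.equiv x, NormalWord.equiv.symm_apply_apply x⟩
  rw [amalgamMap_prod] at hx
  have hletter : ∀ p ∈ w.toList, (p.2 : G) ∉ A p.1.rev := by
    rintro ⟨i, a⟩ hp ha
    exact notMem_range_of_mem_toList w hp
      ⟨⟨a, (mem_zero_one_iff A i a).2 ⟨a.2, ha⟩⟩, Subtype.ext rfl⟩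
  rcases hw : w.toList with _ | ⟨⟨i, a⟩, l⟩
  · rw [hw] at hx
    have : w.head = 1 := by simpa using hx
    simp [NormalWord.prod, CoprodI.Word.prod, hw, this]
  · obtain ⟨n, hn⟩ := exists_list_prod_mem_alternatingProducts A i a l
      (hw ▸ w.chain_ne) (hw ▸ hletter)
    refine absurd ?_ (Set.disjoint_left.1 (h.2.2 n i) hn)
    rw [hw] at hx
    rw [← inv_eq_of_mul_eq_one_right hx]
    exact (w.head⁻¹).2

theorem IsInternalAmalgam.isNontrivialAmalgam {A : Fin 2 → Subgroup G}
    (h : IsInternalAmalgam A) : IsNontrivialAmalgam G := by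
  refine ⟨_, inferInstance, _, inferInstance, interInclusion A, interInclusion_injective A,
    fun i hs => h.1 i fun x hx => ?_,
    ⟨(MulEquiv.ofBijective (amalgamMap A) ⟨h.amalgamMap_injective, h.amalgamMap_surjective⟩).symm⟩⟩
  obtain ⟨c, hc⟩ := hs ⟨x, hx⟩
  obtain rfl : (c : G) = x := congrArg Subtype.val hc
  exact ((mem_zero_one_iff A i c).1 c.2).2

theorem isNontrivialAmalgam_iff : IsNontrivialAmalgam G ↔ ∃ A : Fin 2 → Subgroup G,
    IsInternalAmalgam A :=
  ⟨fun ⟨_, _, _, _, _, hφ, hφ', ⟨e⟩⟩ => ⟨_, isInternalAmalgam_of_mulEquiv hφ hφ' e⟩,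
    fun ⟨_, hA⟩ => hA.isNontrivialAmalgam⟩

end Amalgam

theorem DefinableSet.alternatingProducts
    {S : Fin 2 → ∀ (M : Type u) [Group M], (ℕ → Set M) → Set M} (h : ∀ i, DefinableSet (S i))
    (n : ℕ) (i : Fin 2) :
    DefinableSet (fun M _ R => alternatingProducts (fun i => S i M R) n i) := by
  induction n generalizing i with
  | zero => exact (h i).diff (h i.rev)
  | succ n ih => exact ((h i).diff (h i.rev)).mul (ih i.rev)

theorem isPredicateReduct_isNontrivialAmalgam :
    IsPredicateReduct.{u} (fun G _ => IsNontrivialAmalgam G) := by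
  have hs (i : Fin 2) : DefinableSet.{u} (fun _ _ R => R i) := .symbol i
  refine ⟨_, (DefinableProp.forall_countable fun i => .subgroup (hs i)).and
    ((DefinableProp.forall_countable fun i => (DefinableProp.subset (hs i) (hs i.rev)).not).and
    ((DefinableProp.closure_eq_top ((hs 0).union (hs 1))).and
    (.forall_nat fun n => .forall_countable fun i =>
      .disjoint (.alternatingProducts hs n i) ((hs 0).inter (hs 1))))), fun G _ => ?_⟩
  refine isNontrivialAmalgam_iff.trans ?_
  constructor
  · rintro ⟨A, hA⟩
    let R (n : ℕ) : Set G := if n = 0 then A 0 else A 1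
    have hR (i : Fin 2) : (A i : Set G) = R i := by fin_cases i <;> rfl
    refine ⟨R, fun i => ⟨A i, hR i⟩, ?_⟩
    simpa only [IsInternalAmalgam, hR] using hA
  · rintro ⟨R, hR, h⟩
    choose A hA using hR
    refine ⟨A, ?_⟩
    simpa only [IsInternalAmalgam, hA] using h


/-! ### HNN extensions -/

/-- The expansion has only unary predicates, so the stable letter of an HNN extension is coded by a
singleton. -/
theorem DefinableProp.exists_eq_singleton
    {S : ∀ (M : Type u) [Group M], (ℕ → Set M) → Set M} (h : DefinableSet S) :
    DefinableProp (fun M _ R => ∃ t, S M R = {t}) := by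
  have : DefinableProp (fun M _ R => ¬ (S M R)ᶜ = Set.univ ∧ S M R * (S M R)⁻¹ ⊆ 1) :=
    (eq_univ h.compl).not.and (subset (h.mul h.inv) .one)
  convert this using 4 with M _ R
  rw [Set.compl_univ_iff, ← ne_eq, ← Set.nonempty_iff_ne_empty]
  constructor
  · rintro ⟨t, ht⟩
    simp [ht]
  · rintro ⟨⟨t, ht⟩, h⟩
    refine ⟨t, Set.eq_singleton_iff_unique_mem.2 ⟨ht, fun x hx => ?_⟩⟩
    exact mul_inv_eq_one.1 (h (Set.mul_mem_mul hx (Set.inv_mem_inv.2 ht)))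

section HNN

variable {G : Type u} [Group G]

/-- The set `T` or its inverse, according to the sign `s`. -/
def signed (T : Set G) (s : ℤˣ) : Set G := if s = 1 then T else T⁻¹

theorem signed_singleton (t : G) (s : ℤˣ) : signed {t} s = {t ^ (s : ℤ)} := by
  rcases Int.units_eq_one_or s with rfl | rfl <;> simp [signed]

/-- The elements of `B` that conjugation by the stable letter, with sign `s`, maps into `B`. -/
def associated (B T : Set G) (s : ℤˣ) : Set G := B ∩ ((signed T s)⁻¹ * B * signed T s)

theorem mem_associated_iff {B : Set G} {t b : G} {s : ℤˣ} : b ∈ associated B {t} s ↔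
    b ∈ B ∧ t ^ (s : ℤ) * b * (t ^ (s : ℤ))⁻¹ ∈ B := by
  simp only [associated, signed_singleton, Set.inv_singleton, Set.mem_inter_iff,
    Set.singleton_mul, Set.mul_singleton, Set.mem_image, exists_exists_and_eq_and]
  refine and_congr_right fun _ => ⟨?_, fun h => ⟨_, h, by group⟩⟩
  rintro ⟨x, hx, rfl⟩
  simpa [mul_assoc] using hx

/-- Products of reduced words `t^s b t^s' b' ⋯` with `n + 1` occurrences of the stable letter. -/
def reducedProducts (B T : Set G) : ℕ → ℤˣ → Set G
  | 0, s => signed T s * B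
  | n + 1, s => signed T s * (B * reducedProducts B T n s) ∪
      signed T s * ((B \ associated B T s) * reducedProducts B T n (-s))

/-- The group is the HNN extension of the subgroup `B` with the stable letter `t`. -/
def IsInternalHNN (B : Subgroup G) (t : G) : Prop :=
  Subgroup.closure ((B : Set G) ∪ {t}) = ⊤ ∧
    ∀ n s, Disjoint (reducedProducts (B : Set G) {t} n s) B

open HNNExtension

/-- This is Britton's lemma: a reduced word containing the stable letter has its value outside the
base group. -/
theorem isInternalHNN_of_mulEquiv {B : Type u} [Group B] {A₁ A₂ : Subgroup B} {φ : A₁ ≃* A₂}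
    (e : G ≃* HNNExtension B A₁ A₂ φ) :
    IsInternalHNN ((of (φ := φ)).range.comap e.toMonoidHom) (e.symm t) := by
  set B' : Subgroup G := (of (φ := φ)).range.comap e.toMonoidHom with hB'
  have hof (b : B) : e.symm (of b) ∈ B' := ⟨b, (e.apply_symm_apply _).symm⟩
  refine ⟨eq_top_iff.2 fun x _ => ?_, fun n s => ?_⟩
  · obtain ⟨y, rfl⟩ := e.symm.surjective x
    clear * - hof
    induction y using HNNExtension.induction_on with
    | of b => exact Subgroup.subset_closure (Or.inl (hof b))
    | t => exact Subgroup.subset_closure (Or.inr rfl)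
    | mul y z hy hz => rw [map_mul]; exact mul_mem hy hz
    | inv y hy => rw [map_inv]; exact inv_mem hy
  -- Only this inclusion is needed: a letter outside `associated` is then outside the given
  -- associated subgroup, so the word has no pinch there.
  · have hassoc (s : ℤˣ) (b : B) (hb : b ∈ toSubgroup A₁ A₂ s) :
        e.symm (of b) ∈ associated (B' : Set G) {e.symm t} s := by
      rw [mem_associated_iff]
      refine ⟨hof b, ?_⟩
      rcases Int.units_eq_one_or s with rfl | rfl
      · have := equiv_eq_conj (φ := φ) ⟨b, hb⟩
        have h : e.symm (of (φ ⟨b, hb⟩ : B)) ∈ B' := hof _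
        rw [this] at h
        simpa using h
      · have := equiv_symm_eq_conj (φ := φ) ⟨b, hb⟩
        have h : e.symm (of (φ.symm ⟨b, hb⟩ : B)) ∈ B' := hof _
        rw [this] at h
        simpa using h
    have hword : ∀ x ∈ reducedProducts (B' : Set G) {e.symm t} n s,
        ∃ (b : B) (l : List (ℤˣ × B)),
          ((s, b) :: l).IsChain (fun p q => p.2 ∈ toSubgroup A₁ A₂ p.1 → p.1 = q.1) ∧
          e x = (((s, b) :: l).map fun p => t ^ (p.1 : ℤ) * of p.2).prod := by
      induction n generalizing s with
      | zero =>
        rintro _ ⟨_, hx, y, ⟨b, hb⟩, rfl⟩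
        rw [signed_singleton] at hx
        obtain rfl := hx
        have hb : of b = e y := hb
        exact ⟨b, [], by simp, by simp [hb]⟩
      | succ n ih =>
        rintro _ (⟨_, hx, _, ⟨y, ⟨b, hb⟩, z, hz, rfl⟩, rfl⟩ |
          ⟨_, hx, _, ⟨y, ⟨⟨b, hb⟩, hy⟩, z, hz, rfl⟩, rfl⟩) <;>
        · rw [signed_singleton] at hx
          obtain rfl := hx
          have hb : of b = e y := hb
          obtain ⟨c, l, hl, hzl⟩ := ih _ z hz
          refine ⟨b, _, List.isChain_cons_cons.2 ⟨fun h => ?_, hl⟩, ?_⟩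
          -- In the first summand the adjacent signs agree; in the second, membership in the
          -- associated subgroup contradicts `hy`.
          · first
            | rfl
            | exact absurd (hassoc s b h) (by rwa [hb, e.symm_apply_apply])
          · rw [List.map_cons, List.prod_cons, ← hzl]
            simp [hb, mul_assoc]
    refine Set.disjoint_left.2 fun x hx hx' => ?_
    obtain ⟨b, l, hl, hxl⟩ := hword x hx
    have h := ReducedWord.toList_eq_nil_of_mem_of_range φ ⟨1, (s, b) :: l, hl⟩ (by
      have hx' : e x ∈ (of (φ := φ)).range := hx'
      rw [hxl] at hx'
      simpa [NormalWord.ReducedWord.prod] using hx')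
    exact List.cons_ne_nil _ _ h

/-- The subgroup of those elements of `B` that conjugation by `t` maps into `B`. -/
def conjInto (B : Subgroup G) (t : G) : Subgroup B :=
  (B.comap (MulAut.conj t).toMonoidHom).comap B.subtype

theorem mem_conjInto {B : Subgroup G} {t : G} {b : B} : b ∈ conjInto B t ↔ t * b * t⁻¹ ∈ B :=
  Iff.rfl

/-- Conjugation by `t` as an isomorphism between subgroups of `B`. -/
def conjEquiv (B : Subgroup G) (t : G) : conjInto B t ≃* conjInto B t⁻¹ where
  toFun a := ⟨⟨t * a * t⁻¹, a.2⟩, by simp [mem_conjInto, mul_assoc]⟩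
  invFun a := ⟨⟨t⁻¹ * a * t, by simpa using mem_conjInto.1 a.2⟩, by simp [mem_conjInto, mul_assoc]⟩
  left_inv a := Subtype.ext (Subtype.ext (by simp [mul_assoc]))
  right_inv a := Subtype.ext (Subtype.ext (by simp [mul_assoc]))
  map_mul' a b := Subtype.ext (Subtype.ext (by simp [mul_assoc]))

theorem coe_conjEquiv (B : Subgroup G) (t : G) (a : conjInto B t) :
    ((conjEquiv B t a : B) : G) = t * (a : B) * t⁻¹ := rfl

/-- The two summands of `reducedProducts` match the two cases for adjacent signs: equal signs allow
any element of `B` in between, opposite signs require one outside `associated`. -/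
theorem exists_list_prod_mem_reducedProducts (B : Subgroup G) (t : G) (s : ℤˣ) (b : B)
    (l : List (ℤˣ × B)) (hl : ((s, b) :: l).IsChain
      fun p q => (p.2 : G) ∈ associated (B : Set G) {t} p.1 → p.1 = q.1) :
    ∃ n, (((s, b) :: l).map fun p => t ^ (p.1 : ℤ) * (p.2 : G)).prod ∈
      reducedProducts (B : Set G) {t} n s := by
  induction l generalizing s b with
  | nil => exact ⟨0, by simp [reducedProducts, signed_singleton]⟩
  | cons q l ih =>
    obtain ⟨r, c⟩ := q
    rw [List.isChain_cons_cons] at hl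
    obtain ⟨n, hn⟩ := ih r c hl.2
    refine ⟨n + 1, ?_⟩
    have ht : t ^ (s : ℤ) ∈ signed {t} s := by simp [signed_singleton]
    rw [List.map_cons, List.prod_cons, mul_assoc]
    by_cases h : s = r
    · subst h
      exact Or.inl (Set.mul_mem_mul ht (Set.mul_mem_mul b.2 hn))
    · refine Or.inr (Set.mul_mem_mul ht (Set.mul_mem_mul ⟨b.2, mt hl.1 h⟩ ?_))
      rwa [neg_eq_iff_eq_neg.2 (Int.units_ne_iff_eq_neg.1 h)]

theorem mul_subtype_eq_conjEquiv_mul (B : Subgroup G) (x : G) (a : conjInto B x) :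
    x * B.subtype a = B.subtype (conjEquiv B x a) * x := by
  simp [coe_conjEquiv]

/-- The canonical map from the HNN extension of a subgroup of `G` along conjugation by `x`
to `G`. -/
def hnnMap (B : Subgroup G) (x : G) :
    HNNExtension B (conjInto B x) (conjInto B x⁻¹) (conjEquiv B x) →* G :=
  HNNExtension.lift B.subtype x (mul_subtype_eq_conjEquiv_mul B x)

theorem hnnMap_t (B : Subgroup G) (x : G) : hnnMap B x t = x := by
  rw [hnnMap, lift_t]

theorem hnnMap_of (B : Subgroup G) (x : G) (b : B) : hnnMap B x (of b) = b := by
  rw [hnnMap, lift_of, Subgroup.coe_subtype]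

theorem hnnMap_prod (B : Subgroup G) (x : G)
    (w : NormalWord.ReducedWord B (conjInto B x) (conjInto B x⁻¹)) :
    hnnMap B x (w.prod _) =
      w.head * (w.toList.map fun p => x ^ (p.1 : ℤ) * (p.2 : G)).prod := by
  simp [hnnMap_t, hnnMap_of, NormalWord.ReducedWord.prod, map_list_prod, Function.comp_def]

theorem IsInternalHNN.hnnMap_surjective {B : Subgroup G} {x : G} (h : IsInternalHNN B x) :
    Function.Surjective (hnnMap B x) := by
  rw [← MonoidHom.range_eq_top, eq_top_iff, ← h.1, Subgroup.closure_le]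
  rintro y (hy | rfl)
  · exact ⟨of ⟨y, hy⟩, hnnMap_of _ _ _⟩
  · exact ⟨t, hnnMap_t _ _⟩

/-- As for amalgams: if the normal form of a kernel element contains the stable letter, then a
reduced product equals the inverse of the head, an element of `B`. The associated subgroups are the
largest possible, so reducedness in the extension agrees with reducedness in `G`. -/
theorem IsInternalHNN.hnnMap_injective {B : Subgroup G} {x : G} (h : IsInternalHNN B x) :
    Function.Injective (hnnMap B x) := by
  refine (injective_iff_map_eq_one _).2 fun y hy => ?_
  obtain ⟨d⟩ := NormalWord.TransversalPair.nonempty B (conjInto B x) (conjInto B x⁻¹)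
  obtain ⟨w, rfl⟩ : ∃ w : NormalWord d, w.prod _ = y :=
    ⟨NormalWord.equiv _ d y, (NormalWord.equiv _ d).symm_apply_apply y⟩
  rw [hnnMap_prod] at hy
  have hchain : w.toList.IsChain
      fun p q => (p.2 : G) ∈ associated (B : Set G) {x} p.1 → p.1 = q.1 := by
    refine w.chain.imp fun p q hpq hp => hpq ?_
    obtain ⟨s, b⟩ := p
    have hb := (mem_associated_iff.1 hp).2
    rcases Int.units_eq_one_or s with rfl | rfl
    · simpa [mem_conjInto] using hb
    · simpa [mem_conjInto] using hb
  rcases hw : w.toList with _ | ⟨⟨s, b⟩, l⟩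
  · rw [hw] at hy
    have : w.head = 1 := by simpa using hy
    simp [NormalWord.ReducedWord.prod, hw, this]
  · obtain ⟨n, hn⟩ := exists_list_prod_mem_reducedProducts B x s b l (hw ▸ hchain)
    refine absurd ?_ (Set.disjoint_left.1 (h.2 n s) hn)
    rw [hw] at hy
    rw [← inv_eq_of_mul_eq_one_right hy]
    exact (w.head⁻¹).2

theorem IsInternalHNN.isHNN {B : Subgroup G} {x : G} (h : IsInternalHNN B x) : IsHNN G :=
  ⟨B, inferInstance, _, _, conjEquiv B x,
    ⟨(MulEquiv.ofBijective (hnnMap B x) ⟨h.hnnMap_injective, h.hnnMap_surjective⟩).symm⟩⟩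

theorem isHNN_iff : IsHNN G ↔ ∃ (B : Subgroup G) (t : G), IsInternalHNN B t :=
  ⟨fun ⟨_, _, _, _, _, ⟨e⟩⟩ => ⟨_, _, isInternalHNN_of_mulEquiv e⟩, fun ⟨_, _, h⟩ => h.isHNN⟩

end HNN

namespace DefinableSet

variable {S T : ∀ (M : Type u) [Group M], (ℕ → Set M) → Set M}

theorem signed (h : DefinableSet T) (s : ℤˣ) : DefinableSet (fun M _ R => signed (T M R) s) := by
  unfold GroupClass.signed
  split_ifs
  · exact h
  · exact h.inv

theorem associated (h : DefinableSet S) (h' : DefinableSet T) (s : ℤˣ) :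
    DefinableSet (fun M _ R => associated (S M R) (T M R) s) :=
  h.inter (((h'.signed s).inv.mul h).mul (h'.signed s))

theorem reducedProducts (h : DefinableSet S) (h' : DefinableSet T) (n : ℕ) (s : ℤˣ) :
    DefinableSet (fun M _ R => reducedProducts (S M R) (T M R) n s) := by
  induction n generalizing s with
  | zero => exact (h'.signed s).mul h
  | succ n ih =>
    exact ((h'.signed s).mul (h.mul (ih s))).union
      ((h'.signed s).mul ((h.diff (h.associated h' s)).mul (ih (-s))))

end DefinableSet

theorem isPredicateReduct_isHNN : IsPredicateReduct.{u} (fun G _ => IsHNN G) := by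
  have hB : DefinableSet.{u} (fun _ _ R => R 0) := .symbol 0
  have hT : DefinableSet.{u} (fun _ _ R => R 1) := .symbol 1
  refine ⟨_, (DefinableProp.subgroup hB).and ((DefinableProp.exists_eq_singleton hT).and
    ((DefinableProp.closure_eq_top (hB.union hT)).and
    (.forall_nat fun n => .forall_countable fun s =>
      .disjoint (.reducedProducts hB hT n s) hB))), fun G _ => ?_⟩
  refine isHNN_iff.trans ?_
  constructor
  · rintro ⟨B, t, h⟩
    exact ⟨fun n => if n = 0 then B else {t}, ⟨B, rfl⟩, ⟨t, rfl⟩, h⟩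
  · rintro ⟨R, ⟨B, hB⟩, ⟨t, ht⟩, h⟩
    refine ⟨B, t, ?_⟩
    simpa only [IsInternalHNN, hB, ht] using h

theorem IsPredicateReduct.isReductOfAxiomatizable_and_isBountiful
    {K : ∀ (G : Type u) [Group G], Prop} (h : IsPredicateReduct K) :
    IsReductOfAxiomatizable K ∧ IsBountiful K :=
  ⟨h.isReductOfAxiomatizable, h.isReductOfAxiomatizable.isBountiful⟩

end GroupClass

theorem proposition4p5 :
    -- (1) groups that are not strongly bounded
    (IsReductOfAxiomatizable.{u} (fun G _ => ¬ IsStronglyBounded G) ∧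
      IsBountiful.{u} (fun G _ => ¬ IsStronglyBounded G)) ∧
    -- (2) groups of cofinality at most `ω`
    (IsReductOfAxiomatizable.{u} (fun G _ => HasCofinalityLeOmega G) ∧
      IsBountiful.{u} (fun G _ => HasCofinalityLeOmega G)) ∧
    -- (3) groups that are not Cayley bounded
    (IsReductOfAxiomatizable.{u} (fun G _ => ¬ IsCayleyBounded G) ∧
      IsBountiful.{u} (fun G _ => ¬ IsCayleyBounded G)) ∧
    -- (4) non-trivial amalgamated free products; HNN extensions; the union of the two classes
    (IsReductOfAxiomatizable.{u} (fun G _ => IsNontrivialAmalgam G) ∧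
      IsBountiful.{u} (fun G _ => IsNontrivialAmalgam G)) ∧
    (IsReductOfAxiomatizable.{u} (fun G _ => IsHNN G) ∧
      IsBountiful.{u} (fun G _ => IsHNN G)) ∧
    (IsReductOfAxiomatizable.{u} (fun G _ => IsNontrivialAmalgam G ∨ IsHNN G) ∧
      IsBountiful.{u} (fun G _ => IsNontrivialAmalgam G ∨ IsHNN G)) ∧
    -- (5) groups with a homomorphism onto `ℤ`
    (IsReductOfAxiomatizable.{u} (fun G _ => MapsOntoInt G) ∧
      IsBountiful.{u} (fun G _ => MapsOntoInt G)) ∧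
    -- groups without property FA
    IsBountiful.{u} (fun G _ => ¬ HasFA G) := by
  exact ⟨isPredicateReduct_not_isStronglyBounded.isReductOfAxiomatizable_and_isBountiful,
    isPredicateReduct_hasCofinalityLeOmega.isReductOfAxiomatizable_and_isBountiful,
    isPredicateReduct_not_isCayleyBounded.isReductOfAxiomatizable_and_isBountiful,
    isPredicateReduct_isNontrivialAmalgam.isReductOfAxiomatizable_and_isBountiful,
    isPredicateReduct_isHNN.isReductOfAxiomatizable_and_isBountiful,
    (isPredicateReduct_isNontrivialAmalgam.or
      isPredicateReduct_isHNN).isReductOfAxiomatizable_and_isBountiful,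
    isPredicateReduct_mapsOntoInt.isReductOfAxiomatizable_and_isBountiful,
    isBountiful_not_hasFA⟩
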